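/- Let $x_1x_2x_3\cdots$ be the Ehrenfeucht–Mycielski sequence: the binary sequence that starts $0,1,0$ and continues by the following rule. Given $x_1\cdots x_m$ with $m\ge 3$, take the longest suffix of $x_1\cdots x_m$ that also occurs in it at an earlier (possibly overlapping) position; $x_{m+1}$ is the opposite of the bit that follows the last such earlier occurrence. For $n\ge 1$ let $R_n\subset\{0,1\}^*$ be the set of strings that occur at least twice (overlaps allowed) as substrings of $x_1\cdots x_n$, and for a bit $a$ let $N_n(a)$ be the number of occurrences of $a$ in $x_1\cdots x_n$. Then, as $n\to\infty$, $$|\{b\in R_n : \text{the rightmost bit of } b \text{ is } 0\}| = N_n(0)+o(n),$$ $$|\{b\in R_n : \text{the rightmost bit of } b \text{ is } 1\}| = N_n(1)+o(n).$$ -/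

import Mathlib

open Filter Asymptotics

namespace EhrenfeuchtMycielski

/-- Binary strings: `false` is the bit 0, `true` is the bit 1. Positions in a string are counted
from 0. `OccursAt w x i` says that `w` occurs in `x` as the block starting at position `i`. -/
def OccursAt (w x : List Bool) (i : ℕ) : Prop :=
  i + w.length ≤ x.length ∧ (x.drop i).take w.length = w

instance (w x : List Bool) (i : ℕ) : Decidable (OccursAt w x i) :=
  inferInstanceAs (Decidable (_ ∧ _))

/-- The number of (possibly overlapping) occurrences of `w` in `x`. -/
def numOcc (w x : List Bool) : ℕ :=
  ((Finset.range (x.length + 1)).filter (fun i => OccursAt w x i)).card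

/-- The suffix of `x` of length `l` (for `l ≤ x.length`). -/
def suffix (x : List Bool) (l : ℕ) : List Bool := x.drop (x.length - l)

/-- The suffix of `x` of length `l` also occurs in `x` at position `j`, earlier than at the end. -/
def PrevOcc (x : List Bool) (l j : ℕ) : Prop :=
  j + l < x.length ∧ OccursAt (suffix x l) x j

instance (x : List Bool) (l j : ℕ) : Decidable (PrevOcc x l j) :=
  inferInstanceAs (Decidable (_ ∧ _))

/-- The length of the longest suffix of `x` that has occurred previously. For nonempty `x` the
empty suffix always qualifies. -/
def matchLen (x : List Bool) : ℕ :=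
  Nat.findGreatest (fun l => ∃ j < x.length, PrevOcc x l j) x.length

/-- The position of the last previous occurrence of that longest suffix. -/
def matchPos (x : List Bool) : ℕ :=
  Nat.findGreatest (fun j => PrevOcc x (matchLen x) j) x.length

/-- The opposite of the bit which follows that last previous occurrence. -/
def nextBit (x : List Bool) : Bool := !(x.getD (matchPos x + matchLen x) false)

/-- The initial segment `x_1 ⋯ x_n` of the Ehrenfeucht–Mycielski sequence: it starts `0, 1, 0` and
continues by `nextBit`. -/
def emPrefix : ℕ → List Bool
  | 0 => []
  | 1 => [false]
  | 2 => [false, true]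
  | 3 => [false, true, false]
  | n + 4 => emPrefix (n + 3) ++ [nextBit (emPrefix (n + 3))]

/-- `N_n(w)`: the number of occurrences of `w` in the first `n` bits. -/
def N (n : ℕ) (w : List Bool) : ℕ := numOcc w (emPrefix n)

/-- `R_n`: the set of strings which occur at least twice in the first `n` bits. -/
def R (n : ℕ) : Set (List Bool) := {w | 2 ≤ numOcc w (emPrefix n)}

/-- The strings in `R_n` whose rightmost bit is `a`. -/
def REndingIn (n : ℕ) (a : Bool) : Set (List Bool) := {w | w ∈ R n ∧ w.getLast? = some a}

theorem emPrefix_length : ∀ n, (emPrefix n).length = n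
  | 0 => rfl
  | 1 => rfl
  | 2 => rfl
  | 3 => rfl
  | n + 4 => by simp [emPrefix, emPrefix_length (n + 3)]

theorem emPrefix_prefix_succ : ∀ n, emPrefix n <+: emPrefix (n + 1)
  | 0 => by decide
  | 1 => by decide
  | 2 => by decide
  | n + 3 => by rw [emPrefix]; exact List.prefix_append _ _

/-- In a nonempty string there really is a previous occurrence of the matched suffix. -/
theorem prevOcc_matchPos (x : List Bool) (hx : x ≠ []) : PrevOcc x (matchLen x) (matchPos x) := by
  have hpos : 0 < x.length := List.length_pos_iff.mpr hx
  have h0 : ∃ j < x.length, PrevOcc x 0 j :=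
    ⟨0, hpos, by simpa using hpos, by simp [suffix, OccursAt]⟩
  obtain ⟨j, hj, h⟩ := Nat.findGreatest_spec
    (P := fun l => ∃ j < x.length, PrevOcc x l j) (Nat.zero_le x.length) h0
  exact Nat.findGreatest_spec (P := fun j => PrevOcc x (matchLen x) j) hj.le h

/-- `R_n` is finite, so that `Set.ncard` is the true cardinality of its subsets. -/
theorem R_finite (n : ℕ) : (R n).Finite := by
  refine (List.finite_length_le Bool n).subset fun w hw => ?_
  have hc : 0 < numOcc w (emPrefix n) := lt_of_lt_of_le two_pos hw
  obtain ⟨i, hi⟩ := Finset.card_pos.mp hc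
  have h := (Finset.mem_filter.mp hi).2.1
  rw [emPrefix_length] at h
  exact (Nat.le_add_left _ _).trans h

end EhrenfeuchtMycielski

/-! The rule makes the first two occurrences of any repeated word be followed by different bits
(`em_ne_of_second`). Everything rests on two consequences. Repeated words are short: their length is
`o(n)` (`mul_length_le`). Along the prefixes of a word the second occurrence moves strictly right.
If a repeated word were long, some move would be small and give a short period; but second
occurrences of periodic words must lie far apart, which overruns `n`. Counting leaves then suffices.
Let `L` bound the lengths in `R n`. In the tree of right extensions nearly every leaf occurs, at its
own position, so `|R n| ≤ n + O(L)`. In the tree of left extensions of words ending in `a`, nearly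
every occurrence of `a` ends a leaf of its own, so `N n [a] ≤ |REndingIn n a| + O(L)`. As `N n
[false] + N n [true] = n`, both lower bounds are sharp up to `O(L)`. -/

namespace EhrenfeuchtMycielski

/-! ### The infinite sequence and its blocks -/

/-- The `i`-th bit of the Ehrenfeucht–Mycielski sequence, counted from 0. -/
def em (i : ℕ) : Bool := (emPrefix (i + 1)).getD i false

/-- The block of length `l` of the sequence which starts at position `i`. -/
def block (i l : ℕ) : List Bool := (List.range' i l).map em

@[simp] theorem block_length (i l : ℕ) : (block i l).length = l := by simp [block]

@[simp] theorem block_zero (i : ℕ) : block i 0 = [] := by simp [block]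

theorem block_succ_left (i l : ℕ) : block i (l + 1) = em i :: block (i + 1) l := by
  simp [block, List.range'_succ]

theorem block_succ_right (i l : ℕ) : block i (l + 1) = block i l ++ [em (i + l)] := by
  simp [block, List.range'_concat]

theorem drop_block (i l k : ℕ) : (block i l).drop k = block (i + k) (l - k) := by
  simp [block, ← List.map_drop, List.drop_range']

theorem take_block (i l k : ℕ) : (block i l).take k = block i (min k l) := by
  rw [block, block, ← List.map_take]
  congr 1
  apply List.ext_getElem <;> simp

theorem getElem?_block {i l k : ℕ} (h : k < l) : (block i l)[k]? = some (em (i + k)) := by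
  simp [block, h]

theorem block_eq_block_iff {i j l : ℕ} :
    block i l = block j l ↔ ∀ k < l, em (i + k) = em (j + k) := by
  constructor
  · intro h k hk
    have := congrArg (fun w => w[k]?) h
    simpa [getElem?_block hk] using this
  · intro h
    induction l with
    | zero => simp
    | succ l ih =>
      rw [block_succ_right, block_succ_right, ih fun k hk => h k (by omega), h l (by omega)]

theorem emPrefix_succ (n : ℕ) : emPrefix (n + 1) = emPrefix n ++ [em n] := by
  obtain ⟨t, ht⟩ := emPrefix_prefix_succ n
  have hl := congrArg List.length ht
  rw [List.length_append, emPrefix_length, emPrefix_length] at hl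
  obtain ⟨b, rfl⟩ := List.length_eq_one_iff.mp (show t.length = 1 by omega)
  have : em n = b := by
    rw [em, ← ht]
    simp [List.getD_eq_getElem?_getD, emPrefix_length]
  rw [this, ht]

theorem emPrefix_eq_block (n : ℕ) : emPrefix n = block 0 n := by
  induction n with
  | zero => rfl
  | succ n ih => rw [emPrefix_succ, ih, block_succ_right, zero_add]

theorem em_eq_nextBit {m : ℕ} (hm : 3 ≤ m) : em m = nextBit (emPrefix m) := by
  obtain ⟨n, rfl⟩ := Nat.exists_eq_add_of_le' hm
  have h := emPrefix_succ (n + 3)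
  rw [emPrefix] at h
  simpa using (List.append_cancel_left h).symm

theorem occursAt_emPrefix_iff {w : List Bool} {n i : ℕ} :
    OccursAt w (emPrefix n) i ↔ i + w.length ≤ n ∧ block i w.length = w := by
  unfold OccursAt
  rw [emPrefix_length]
  refine and_congr_right fun h => ?_
  rw [emPrefix_eq_block, drop_block, take_block, zero_add, min_eq_left (by omega)]

/-! ### Bits following the first two occurrences -/

/-- The first two occurrences of a word in the sequence are followed by different bits. -/
theorem em_ne_of_second {i j l : ℕ} (hij : i < j) (h : block i l = block j l)
    (huniq : ∀ k < j, block k l = block j l → k = i) : em (i + l) ≠ em (j + l) := by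
  by_cases hm : 3 ≤ j + l
  · have hne : emPrefix (j + l) ≠ [] := by
      rw [← List.length_pos_iff, emPrefix_length]; omega
    have hsuf : ∀ M ≤ j + l, suffix (emPrefix (j + l)) M = block (j + l - M) M := by
      intro M hM
      rw [suffix, emPrefix_length, emPrefix_eq_block, drop_block, zero_add, Nat.sub_sub_self hM]
    have hp := prevOcc_matchPos _ hne
    have hl : l ≤ matchLen (emPrefix (j + l)) := by
      refine Nat.le_findGreatest (by rw [emPrefix_length]; omega) ⟨i, ?_, ?_, ?_⟩
      · rw [emPrefix_length]; omega
      · rw [emPrefix_length]; omega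
      · rw [hsuf l (by omega), occursAt_emPrefix_iff, block_length, Nat.add_sub_cancel]
        exact ⟨by omega, h⟩
    have hb := em_eq_nextBit hm
    rw [nextBit] at hb
    generalize matchPos (emPrefix (j + l)) = p at *
    generalize matchLen (emPrefix (j + l)) = M at *
    obtain ⟨h1, h2⟩ := hp
    rw [emPrefix_length] at h1
    rw [hsuf M (by omega), occursAt_emPrefix_iff, block_length] at h2
    -- The last `l` letters of the longest match recur at `p + (M - l) < j`, which uniqueness forces
    -- to be `i`; so the bit being negated is `em (i + l)`.
    have h3 := congrArg (List.drop (M - l)) h2.2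
    rw [drop_block, drop_block, Nat.sub_sub_self hl,
      show j + l - M + (M - l) = j by omega] at h3
    have h4 := huniq _ (by omega) h3
    have h5 : p + M = i + l := by omega
    rw [h5, emPrefix_eq_block, List.getD_eq_getElem?_getD, getElem?_block (by omega)] at hb
    rw [hb]
    simp
  · have h01 : em 0 ≠ em 1 := by decide
    have hcase : (l = 0) ∨ (l = 1 ∧ j = 1) := by omega
    rcases hcase with rfl | ⟨rfl, rfl⟩
    · have h0 := huniq 0 (by omega) (by simp)
      subst h0
      have : j = 1 := by
        by_contra hj
        have := huniq 1 (by omega) (by simp)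
        omega
      subst this
      exact h01
    · obtain rfl : i = 0 := by omega
      exact absurd (block_eq_block_iff.mp h 0 one_pos) h01

/-! ### Repeated words are short -/

/-- `j` starts an occurrence of the first `t` letters of the infinite word `w`, and it is not the
first one. -/
def Repeats (w : ℕ → Bool) (t j : ℕ) : Prop :=
  (∀ k < t, em (j + k) = w k) ∧ ∃ i < j, ∀ k < t, em (i + k) = w k

theorem Repeats.mono {w : ℕ → Bool} {t u j : ℕ} (h : Repeats w u j) (htu : t ≤ u) :
    Repeats w t j := by
  obtain ⟨h1, i, hi, h2⟩ := h
  exact ⟨fun k hk => h1 k (by omega), i, hi, fun k hk => h2 k (by omega)⟩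

open Classical in
/-- The position of the second occurrence of the first `t` letters of `w`. -/
noncomputable def secondPos (w : ℕ → Bool) (t : ℕ) : ℕ :=
  if h : ∃ j, Repeats w t j then Nat.find h else 0

theorem repeats_secondPos {w : ℕ → Bool} {t j : ℕ} (h : Repeats w t j) :
    Repeats w t (secondPos w t) := by
  classical
  have h' : ∃ j, Repeats w t j := ⟨j, h⟩
  rw [secondPos, dif_pos h']
  exact Nat.find_spec h'

theorem secondPos_le {w : ℕ → Bool} {t j : ℕ} (h : Repeats w t j) : secondPos w t ≤ j := by
  classical
  have h' : ∃ j, Repeats w t j := ⟨j, h⟩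
  rw [secondPos, dif_pos h']
  exact Nat.find_min' h' h

/-- Were the two positions equal, the first two occurrences of the shorter prefix would both be
followed by `w t`. -/
theorem secondPos_lt_succ {w : ℕ → Bool} {t j : ℕ} (h : Repeats w (t + 1) j) :
    secondPos w t < secondPos w (t + 1) := by
  have hs := repeats_secondPos h
  refine lt_of_le_of_ne (secondPos_le (hs.mono t.le_succ)) fun heq => ?_
  obtain ⟨h1, i, hi, h2⟩ := hs
  refine em_ne_of_second (l := t) hi ?_ ?_ (by rw [h1 t (by omega), h2 t (by omega)])
  · exact block_eq_block_iff.mpr fun k hk => by rw [h1 k (by omega), h2 k (by omega)]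
  · intro k hk hkb
    by_contra hne
    have hkw : ∀ a < t, em (k + a) = w a := fun a ha => by
      rw [block_eq_block_iff.mp hkb a ha, h1 a (by omega)]
    have hiw : ∀ a < t, em (i + a) = w a := fun a ha => h2 a (by omega)
    rcases Nat.lt_or_gt_of_ne hne with hlt | hlt
    · have := secondPos_le (w := w) (t := t) (j := i) ⟨hiw, k, hlt, hkw⟩
      omega
    · have := secondPos_le (w := w) (t := t) (j := k) ⟨hkw, i, hlt, hiw⟩
      omega

/-- An occurrence of the first `t` letters of a word with period `d` extends as far as a later
occurrence which overlaps it in at least `d` letters. -/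
theorem occurs_of_overlap {w : ℕ → Bool} {t d r s u : ℕ} (hd : 0 < d) (hdt : d ≤ t)
    (hper : ∀ k, k + d < r → w (k + d) = w k) (hs : ∀ k < t, em (s + k) = w k)
    (hu : ∀ k < r, em (u + k) = w k) (hsu : s ≤ u) (hov : u + d ≤ s + t) :
    ∀ k < r, em (s + k) = w k := by
  intro k
  induction k using Nat.strong_induction_on with
  | _ k ih =>
    intro hk
    by_cases hkt : k < t
    · exact hs k hkt
    · obtain ⟨a, rfl⟩ := Nat.exists_eq_add_of_le' (show d ≤ k by omega)
      obtain ⟨b, hb⟩ := Nat.exists_eq_add_of_le (show u ≤ s + a by omega)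
      rw [show s + (a + d) = u + (b + d) by omega, hu _ (by omega), hper _ (by omega),
        ← hu _ (by omega), ← hb, ih a (by omega) (by omega), hper _ hk]

/-- Otherwise the second occurrences for lengths `t` and `t + 1` overlap that for `t + 2` in at
least `d` letters, so by periodicity both extend to length `t + 2`. That gives two occurrences
before the second one. -/
theorem lt_secondPos_add_two {w : ℕ → Bool} {t d j : ℕ} (h : Repeats w (t + 2) j) (hd : 0 < d)
    (hdt : d ≤ t) (hper : ∀ k, k + d < t + 2 → w (k + d) = w k) :
    secondPos w t + t < secondPos w (t + 2) + d := by
  by_contra! hcon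
  have l1 : secondPos w (t + 1) < secondPos w (t + 2) := secondPos_lt_succ h
  have l0 := secondPos_lt_succ (h.mono (Nat.le_succ (t + 1)))
  have s2 := repeats_secondPos h
  have s1 := repeats_secondPos (h.mono (Nat.le_succ (t + 1)))
  have s0 := repeats_secondPos (h.mono (show t ≤ t + 2 by omega))
  have e0 := occurs_of_overlap hd hdt hper s0.1 s2.1 (by omega) hcon
  have e1 := occurs_of_overlap hd hdt hper (s1.mono t.le_succ).1 s2.1 (by omega) (by omega)
  have := secondPos_le (w := w) (t := t + 2) ⟨e1, _, l0, e0⟩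
  omega

theorem exists_small_gap {f : ℕ → ℕ} {a b c n : ℕ} (hb : f (a + b) ≤ n) (hn : n < b * c) :
    ∃ t < b, f (a + t + 1) < f (a + t) + c := by
  by_contra! hcon
  have : ∀ t ≤ b, t * c ≤ f (a + t) := by
    intro t
    induction t with
    | zero => simp
    | succ t ih =>
      intro ht
      have := hcon t (by omega)
      have := ih (by omega)
      rw [Nat.succ_mul, ← add_assoc]
      omega
  have := this b le_rfl
  omega

/-- Repeated words are short compared with the length of the initial segment. -/
theorem mul_length_le_of_repeats {K n L j : ℕ} {w : ℕ → Bool}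
    (hn : K * (40 * K + 40) ≤ n) (h : Repeats w L j) (hj : j + L ≤ n) : K * L ≤ n := by
  by_contra! hcon
  have hL : 40 * K + 40 < L := by
    by_contra! hle
    have := Nat.mul_le_mul_left K hle
    omega
  have hsL := secondPos_le h
  -- At least `L / 2` successive moves end at or below `n < K * L`, so one of them is less than `2 *
  -- K`.
  obtain ⟨t, ht, hgap⟩ := exists_small_gap (f := secondPos w) (a := L / 2) (b := L - L / 2)
    (c := 2 * K) (n := n) (by rw [show L / 2 + (L - L / 2) = L by omega]; omega) (by
      have : L ≤ (L - L / 2) * 2 := by omega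
      calc n < K * L := hcon
        _ ≤ K * ((L - L / 2) * 2) := Nat.mul_le_mul_left _ this
        _ = _ := by ring)
  obtain ⟨T, hT⟩ : ∃ T, T = L / 2 + t := ⟨_, rfl⟩
  rw [← hT] at hgap
  have hTL : T + 1 ≤ L := by omega
  have hlt := secondPos_lt_succ (h.mono hTL)
  obtain ⟨d, hd⟩ := Nat.exists_eq_add_of_lt hlt
  have q0 := repeats_secondPos (h.mono (show T ≤ L by omega))
  have q1 := repeats_secondPos (h.mono hTL)
  -- Two occurrences of the first `T` letters at distance `d + 1` overlap, so `d + 1` is a period.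
  have hper : ∀ k, k + (d + 1) < T → w (k + (d + 1)) = w k := by
    intro k hk
    rw [← q0.1 _ hk, ← q1.1 k (by omega), hd]
    congr 1
    omega
  -- From length `a` to `T` there are `4 * K` double steps, each moving the second occurrence by at
  -- least `a - 2 * K`, since `d + 1 < 2 * K`.
  obtain ⟨a, ha⟩ : ∃ a, T = a + 2 * (4 * K) := ⟨T - 2 * (4 * K), by omega⟩
  have hsum : ∀ b ≤ 4 * K, b * (a - 2 * K) ≤ secondPos w (a + 2 * b) := by
    intro b
    induction b with
    | zero => simp
    | succ b ih =>
      intro hb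
      have h1 := ih (by omega)
      have h2 := lt_secondPos_add_two (t := a + 2 * b) (d := d + 1) (h.mono (by omega))
        (by omega) (by omega) (fun k hk => hper k (by omega))
      rw [Nat.succ_mul, show a + 2 * (b + 1) = a + 2 * b + 2 by ring]
      omega
  have h1 := hsum _ le_rfl
  have h2 := secondPos_le (h.mono (show T ≤ L by omega))
  -- Here `a ≥ L / 2 - 8 * K` and `L > 40 * K + 40` are used.
  have h3 : K * L ≤ K * (4 * (a - 2 * K)) := Nat.mul_le_mul_left _ (by omega)
  have h4 : K * (4 * (a - 2 * K)) = 4 * K * (a - 2 * K) := by ring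
  rw [← ha] at h1
  omega

/-! ### Factors and extensions of repeated words -/

theorem mem_R_iff {n : ℕ} {w : List Bool} :
    w ∈ R n ↔ ∃ i j, i < j ∧ j + w.length ≤ n ∧ block i w.length = w ∧ block j w.length = w := by
  rw [R, Set.mem_ofPred_eq, numOcc, ← Nat.lt_iff_add_one_le, Finset.one_lt_card]
  simp only [Finset.mem_filter, Finset.mem_range, emPrefix_length, occursAt_emPrefix_iff]
  constructor
  · rintro ⟨i, ⟨-, hi, hi'⟩, j, ⟨-, hj, hj'⟩, hne⟩
    rcases Nat.lt_or_gt_of_ne hne with hlt | hlt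
    · exact ⟨i, j, hlt, hj, hi', hj'⟩
    · exact ⟨j, i, hlt, hi, hj', hi'⟩
  · rintro ⟨i, j, hij, hj, h1, h2⟩
    exact ⟨i, ⟨by omega, by omega, h1⟩, j, ⟨by omega, hj, h2⟩, hij.ne⟩

theorem mul_length_le {K n : ℕ} {w : List Bool} (hn : K * (40 * K + 40) ≤ n) (hw : w ∈ R n) :
    K * w.length ≤ n := by
  obtain ⟨i, j, hij, hj, h1, h2⟩ := mem_R_iff.mp hw
  refine mul_length_le_of_repeats (w := fun k => em (j + k)) hn ⟨fun _ _ => rfl, i, hij, ?_⟩ hj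
  exact block_eq_block_iff.mp (h1.trans h2.symm)

theorem block_add (i a b : ℕ) : block i (a + b) = block i a ++ block (i + a) b := by
  induction b with
  | zero => simp
  | succ b ih =>
    rw [← add_assoc, block_succ_right, ih, block_succ_right, List.append_assoc, add_assoc]

theorem block_append_eq {i : ℕ} {u v : List Bool} (h : block i (u ++ v).length = u ++ v) :
    block i u.length = u ∧ block (i + u.length) v.length = v := by
  rw [List.length_append, block_add] at h
  exact List.append_inj h (by simp)

theorem mem_R_of_append_left {n : ℕ} {u v : List Bool} (h : u ++ v ∈ R n) : u ∈ R n := by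
  obtain ⟨i, j, hij, hj, h1, h2⟩ := mem_R_iff.mp h
  rw [List.length_append] at hj
  exact mem_R_iff.mpr ⟨i, j, hij, by omega, (block_append_eq h1).1, (block_append_eq h2).1⟩

theorem mem_R_of_append_right {n : ℕ} {u v : List Bool} (h : u ++ v ∈ R n) : v ∈ R n := by
  obtain ⟨i, j, hij, hj, h1, h2⟩ := mem_R_iff.mp h
  rw [List.length_append] at hj
  exact mem_R_iff.mpr ⟨_, _, by omega, by omega, (block_append_eq h1).2, (block_append_eq h2).2⟩

theorem eq_of_notMem_R {n i j : ℕ} {w : List Bool} (h : w ∉ R n) (hi : i + w.length ≤ n)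
    (hj : j + w.length ≤ n) (h1 : block i w.length = w) (h2 : block j w.length = w) : i = j := by
  by_contra hne
  rcases Nat.lt_or_gt_of_ne hne with hlt | hlt
  · exact h (mem_R_iff.mpr ⟨i, j, hlt, hj, h1, h2⟩)
  · exact h (mem_R_iff.mpr ⟨j, i, hlt, hi, h2, h1⟩)

theorem nil_mem_R {n : ℕ} (hn : 0 < n) : [] ∈ R n :=
  mem_R_iff.mpr ⟨0, 1, one_pos, hn, by simp, by simp⟩

/-- A repeated word which is not a suffix of the initial segment is followed there by both bits. -/
theorem exists_occurrence_append {n : ℕ} {v : List Bool} (h : v ∈ R n)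
    (hv : v ≠ block (n - v.length) v.length) (b : Bool) :
    ∃ i, i + (v ++ [b]).length ≤ n ∧ block i (v ++ [b]).length = v ++ [b] := by
  classical
  have hex : ∃ j, ∃ i < j, j + v.length ≤ n ∧ block i v.length = v ∧ block j v.length = v := by
    obtain ⟨i, j, hij, hj⟩ := mem_R_iff.mp h
    exact ⟨j, i, hij, hj⟩
  obtain ⟨j, ⟨i, hij, hj, h1, h2⟩, hmin⟩ : ∃ j, (∃ i < j, j + v.length ≤ n ∧
      block i v.length = v ∧ block j v.length = v) ∧ ∀ k < j, ¬ ∃ i < k, k + v.length ≤ n ∧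
      block i v.length = v ∧ block k v.length = v :=
    ⟨Nat.find hex, Nat.find_spec hex, fun k hk => Nat.find_min hex hk⟩
  -- The second occurrence is not at the end, so both following bits lie within the first `n`.
  have hlt : j + v.length < n := by
    refine lt_of_le_of_ne hj fun he => hv ?_
    rw [← he, Nat.add_sub_cancel, h2]
  have hne : em (i + v.length) ≠ em (j + v.length) := by
    refine em_ne_of_second hij (h1.trans h2.symm) fun k hk hkb => ?_
    by_contra hki
    rcases Nat.lt_or_gt_of_ne hki with hki | hki
    · exact hmin i hij ⟨k, hki, by omega, hkb.trans h2, h1⟩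
    · exact hmin k hk ⟨i, hki, by omega, h1, hkb.trans h2⟩
  have hb : em (i + v.length) = b ∨ em (j + v.length) = b := by
    revert hne
    cases em (i + v.length) <;> cases em (j + v.length) <;> cases b <;> simp
  rw [List.length_append, List.length_singleton]
  rcases hb with hb | hb
  · exact ⟨i, by omega, by rw [block_succ_right, h1, hb]⟩
  · exact ⟨j, by omega, by rw [block_succ_right, h2, hb]⟩

/-! ### Right leaves and the size of `R n` -/

/-- `R n` as a finset. -/
noncomputable def RFinset (n : ℕ) : Finset (List Bool) := (R_finite n).toFinset

@[simp] theorem mem_RFinset {n : ℕ} {w : List Bool} : w ∈ RFinset n ↔ w ∈ R n := by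
  simp [RFinset]

/-- The words outside `R n` which arise by appending a bit to a word of `R n`. -/
noncomputable def rightLeaves (n : ℕ) : Finset (List Bool) :=
  ((RFinset n ×ˢ Finset.univ).image fun p : List Bool × Bool => p.1 ++ [p.2]) \ RFinset n

theorem mem_rightLeaves {n : ℕ} {w : List Bool} :
    w ∈ rightLeaves n ↔ (∃ v ∈ R n, ∃ b, v ++ [b] = w) ∧ w ∉ R n := by
  simp [rightLeaves]

/-- Of the `2 * |R n|` right extensions, those in `R n` are nonempty, so at most `|R n| - 1` of them
are not leaves. -/
theorem card_RFinset_lt {n : ℕ} (hn : 0 < n) : (RFinset n).card < (rightLeaves n).card := by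
  set S := (RFinset n ×ˢ Finset.univ).image fun p : List Bool × Bool => p.1 ++ [p.2] with hS
  have hcard : S.card = 2 * (RFinset n).card := by
    rw [hS, Finset.card_image_of_injective, Finset.card_product, Finset.card_univ,
      Fintype.card_bool, mul_comm]
    rintro ⟨u, a⟩ ⟨v, b⟩ h
    simpa using h
  have hnil : [] ∈ RFinset n := mem_RFinset.mpr (nil_mem_R hn)
  have hsub : S ⊆ rightLeaves n ∪ (RFinset n).erase [] := by
    intro w hw
    by_cases hR : w ∈ RFinset n
    · refine Finset.mem_union_right _ (Finset.mem_erase.mpr ⟨?_, hR⟩)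
      rintro rfl
      simp [hS] at hw
    · exact Finset.mem_union_left _ (Finset.mem_sdiff.mpr ⟨hw, hR⟩)
  have h1 := (Finset.card_le_card hsub).trans (Finset.card_union_le _ _)
  have h2 := Finset.card_erase_add_one hnil
  omega

/-- A leaf can fail to occur only if it extends a suffix of the initial segment, which accounts for
the set `T`. Leaves that occur start at distinct positions, since no leaf is a proper prefix of
another. -/
theorem card_rightLeaves_le {n L : ℕ} (hL : ∀ w ∈ R n, w.length ≤ L) :
    (rightLeaves n).card ≤ n + 2 * (L + 1) := by
  classical
  set T := (Finset.range (L + 1) ×ˢ Finset.univ).image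
    fun p : ℕ × Bool => block (n - p.1) p.1 ++ [p.2] with hT
  have hTcard : T.card ≤ 2 * (L + 1) := by
    refine Finset.card_image_le.trans ?_
    rw [Finset.card_product, Finset.card_range, Finset.card_univ, Fintype.card_bool, mul_comm]
  have hocc : ∀ w ∈ rightLeaves n \ T, ∃ i, i + w.length ≤ n ∧ block i w.length = w := by
    intro w hw
    rw [Finset.mem_sdiff, mem_rightLeaves] at hw
    obtain ⟨⟨⟨v, hv, b, rfl⟩, -⟩, hwT⟩ := hw
    refine exists_occurrence_append hv (fun he => hwT ?_) b
    rw [hT, Finset.mem_image]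
    refine ⟨(v.length, b), ?_, by rw [← he]⟩
    simpa [Nat.lt_succ_iff] using hL v hv
  choose! f hf1 hf2 using hocc
  have hprefix : ∀ u ∈ rightLeaves n, ∀ w ∈ rightLeaves n, ∀ i, block i u.length = u →
      block i w.length = w → ¬ u.length < w.length := by
    intro u hu w hw i h1 h2 hlt
    rw [mem_rightLeaves] at hu hw
    obtain ⟨⟨v, hv, b, rfl⟩, -⟩ := hw
    have h3 := (block_append_eq h2).1
    rw [List.length_append, List.length_singleton] at hlt
    obtain ⟨c, hc⟩ := Nat.exists_eq_add_of_le (Nat.lt_succ_iff.mp hlt)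
    rw [hc, block_add, h1] at h3
    exact hu.2 (mem_R_of_append_left (h3 ▸ hv))
  have hcard : (rightLeaves n \ T).card ≤ (Finset.range n).card := by
    refine Finset.card_le_card_of_injOn f ?_ ?_
    · intro w hw
      have h1 := hf1 w hw
      obtain ⟨⟨⟨v, -, b, rfl⟩, -⟩, -⟩ := by
        rw [Finset.mem_coe, Finset.mem_sdiff, mem_rightLeaves] at hw
        exact hw
      rw [List.length_append, List.length_singleton] at h1
      simp only [Finset.coe_range, Set.mem_Iio]
      omega
    · intro u hu w hw huw
      have hu' := hf2 u hu
      have hw' := hf2 w hw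
      rw [← huw] at hw'
      have hu1 := (Finset.mem_sdiff.mp (Finset.mem_coe.mp hu)).1
      have hw1 := (Finset.mem_sdiff.mp (Finset.mem_coe.mp hw)).1
      have h1 := hprefix u hu1 w hw1 _ hu' hw'
      have h2 := hprefix w hw1 u hu1 _ hw' hu'
      rw [← hu', ← hw', show u.length = w.length by omega]
  rw [Finset.card_range] at hcard
  have := Finset.card_le_card_sdiff_add_card (s := rightLeaves n) (t := T)
  omega

/-! ### Left leaves and occurrences of a bit -/

/-- `REndingIn n a` as a finset. -/
noncomputable def endingFinset (n : ℕ) (a : Bool) : Finset (List Bool) :=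
  (RFinset n).filter fun w => w.getLast? = some a

@[simp] theorem mem_endingFinset {n : ℕ} {a : Bool} {w : List Bool} :
    w ∈ endingFinset n a ↔ w ∈ R n ∧ w.getLast? = some a := by
  simp [endingFinset]

theorem ncard_REndingIn (n : ℕ) (a : Bool) :
    (REndingIn n a).ncard = (endingFinset n a).card := by
  rw [← Set.ncard_coe_finset]
  congr 1
  ext w
  simp [REndingIn]

theorem card_endingFinset_add {n : ℕ} (hn : 0 < n) :
    (endingFinset n false).card + (endingFinset n true).card + 1 = (RFinset n).card := by
  have hd : Disjoint (endingFinset n false) (endingFinset n true) := by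
    rw [Finset.disjoint_left]
    intro w h1 h2
    rw [mem_endingFinset] at h1 h2
    simpa using h1.2.symm.trans h2.2
  rw [← Finset.card_union_of_disjoint hd,
    ← Finset.card_erase_add_one (mem_RFinset.mpr (nil_mem_R hn))]
  congr 2
  ext w
  rcases List.eq_nil_or_concat w with rfl | ⟨v, b, rfl⟩
  · simp
  · cases b <;> simp

theorem N_singleton (n : ℕ) (a : Bool) :
    N n [a] = ((Finset.range n).filter fun j => em j = a).card := by
  rw [N, numOcc]
  congr 1
  ext j
  have hb : block j 1 = [em j] := rfl
  simp only [Finset.mem_filter, Finset.mem_range, emPrefix_length, occursAt_emPrefix_iff,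
    List.length_singleton, hb, List.cons.injEq, and_true]
  exact ⟨fun h => ⟨h.2.1, h.2.2⟩, fun h => ⟨by omega, h.1, h.2⟩⟩

theorem N_add_N (n : ℕ) : N n [false] + N n [true] = n := by
  rw [N_singleton, N_singleton]
  simpa using Finset.card_filter_add_card_filter_not (s := Finset.range n) (fun j => em j = false)

/-- The words outside `R n` which arise by prepending a bit to a word of `R n` ending in `a`. -/
noncomputable def leftLeaves (n : ℕ) (a : Bool) : Finset (List Bool) :=
  ((endingFinset n a ×ˢ Finset.univ).image fun p : List Bool × Bool => p.2 :: p.1) \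
    endingFinset n a

/-- Every word of `endingFinset n a` except `[a]` is itself a left extension, because its tail is
repeated and ends in `a`. -/
theorem card_leftLeaves_le (n : ℕ) (a : Bool) :
    (leftLeaves n a).card ≤ (endingFinset n a).card + 1 := by
  set S := (endingFinset n a ×ˢ Finset.univ).image fun p : List Bool × Bool => p.2 :: p.1 with hS
  have hcard : S.card = 2 * (endingFinset n a).card := by
    rw [hS, Finset.card_image_of_injective, Finset.card_product, Finset.card_univ,
      Fintype.card_bool, mul_comm]
    rintro ⟨u, c⟩ ⟨v, d⟩ h
    simpa [and_comm] using h
  have hsub : leftLeaves n a ∪ (endingFinset n a).erase [a] ⊆ S := by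
    intro w hw
    rcases Finset.mem_union.mp hw with hw | hw
    · exact (Finset.mem_sdiff.mp hw).1
    · obtain ⟨hne, hw⟩ := Finset.mem_erase.mp hw
      rw [mem_endingFinset] at hw
      rw [hS, Finset.mem_image]
      rcases w with _ | ⟨c, _ | ⟨d, v⟩⟩
      · simp at hw
      · simp at hw hne
        exact absurd hw.2 hne
      · refine ⟨(d :: v, c), ?_, rfl⟩
        have : d :: v ∈ R n := mem_R_of_append_right (u := [c]) hw.1
        have h2 := hw.2
        rw [List.getLast?_cons_cons] at h2
        simp [this, h2]
  have hd : Disjoint (leftLeaves n a) ((endingFinset n a).erase [a]) :=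
    Finset.disjoint_of_subset_right (Finset.erase_subset _ _) Finset.sdiff_disjoint
  have h1 := Finset.card_le_card hsub
  rw [Finset.card_union_of_disjoint hd] at h1
  have h2 := Finset.pred_card_le_card_erase (s := endingFinset n a) (a := [a])
  omega

/-- An occurrence of a bit either ends a repeated prefix of the sequence, or it ends an occurrence
of a left leaf. -/
theorem exists_leftLeaf {n j : ℕ} {a : Bool} (ha : [a] ∈ R n) (hja : em j = a)
    (hp : block 0 (j + 1) ∉ R n) :
    ∃ w ∈ leftLeaves n a, ∃ i, i + w.length = j + 1 ∧ block i w.length = w := by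
  classical
  -- The leaf is the shortest block ending at `j` outside `R n`; by minimality its tail is in `R n`.
  have hex : ∃ l, l ≤ j ∧ block (j - l) (l + 1) ∉ R n := ⟨j, le_rfl, by simpa using hp⟩
  obtain ⟨l, ⟨hl, hlR⟩, hmin⟩ : ∃ l, (l ≤ j ∧ block (j - l) (l + 1) ∉ R n) ∧
      ∀ k < l, ¬ (k ≤ j ∧ block (j - k) (k + 1) ∉ R n) :=
    ⟨Nat.find hex, Nat.find_spec hex, fun k hk => Nat.find_min hex hk⟩
  rcases l with _ | l
  · simp [block_succ_left, hja, ha] at hlR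
  · refine ⟨block (j - (l + 1)) (l + 1 + 1), ?_, j - (l + 1), by rw [block_length]; omega,
      by rw [block_length]⟩
    have hR : block (j - l) (l + 1) ∈ R n := by
      by_contra hR
      exact hmin l (by omega) ⟨by omega, hR⟩
    have hlast : (block (j - l) (l + 1)).getLast? = some a := by
      rw [block_succ_right, List.getLast?_concat, Nat.sub_add_cancel (by omega), hja]
    rw [leftLeaves, Finset.mem_sdiff, Finset.mem_image]
    refine ⟨⟨(block (j - l) (l + 1), em (j - (l + 1))), ?_, ?_⟩, fun h => ?_⟩
    · simp [hR, hlast]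
    · rw [block_succ_left _ (l + 1), show j - (l + 1) + 1 = j - l by omega]
    · exact hlR (mem_endingFinset.mp h).1

/-- Past the first `L` positions every `a` ends a left leaf. A leaf is not repeated, so different
occurrences of `a` get different leaves. -/
theorem N_le {n L : ℕ} (hL : ∀ w ∈ R n, w.length ≤ L) (a : Bool) :
    N n [a] ≤ (endingFinset n a).card + L + 1 := by
  classical
  by_cases ha : 2 ≤ N n [a]
  swap
  · omega
  rw [N_singleton]
  set J := (Finset.range n).filter fun j => em j = a with hJ
  have hleaf : ∀ j ∈ J \ Finset.range L,
      ∃ w ∈ leftLeaves n a, ∃ i, i + w.length = j + 1 ∧ block i w.length = w := by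
    intro j hj
    simp only [hJ, Finset.mem_sdiff, Finset.mem_filter, Finset.mem_range] at hj
    refine exists_leftLeaf ha hj.1.2 fun h => ?_
    have := hL _ h
    rw [block_length] at this
    omega
  choose! f hf1 g hg1 hg2 using hleaf
  have hcard : (J \ Finset.range L).card ≤ (leftLeaves n a).card := by
    refine Finset.card_le_card_of_injOn f hf1 ?_
    intro j hj k hk hjk
    have hlt : ∀ j ∈ J \ Finset.range L, j < n := fun j hj =>
      Finset.mem_range.mp (Finset.mem_filter.mp (Finset.mem_sdiff.mp hj).1).1
    have hj1 := hlt j hj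
    have hk1 := hlt k hk
    have hR : f j ∉ R n := by
      have h := hf1 j hj
      rw [leftLeaves, Finset.mem_sdiff, Finset.mem_image] at h
      obtain ⟨⟨p, hp, hpe⟩, h2⟩ := h
      refine fun hmem => h2 (mem_endingFinset.mpr ⟨hmem, ?_⟩)
      have hp2 := (mem_endingFinset.mp (Finset.mem_product.mp hp).1).2
      rw [← hpe, List.getLast?_cons, hp2]
      rfl
    have a1 := hg1 j hj
    have a2 := hg1 k hk
    have b1 := hg2 j hj
    have b2 := hg2 k hk
    rw [← hjk] at a2 b2
    have := eq_of_notMem_R hR (by omega) (by omega) b1 b2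
    omega
  have h1 := Finset.card_le_card_sdiff_add_card (s := J) (t := Finset.range L)
  rw [Finset.card_range] at h1
  have h2 := card_leftLeaves_le n a
  omega

/-! ### The asymptotic estimate -/

/-- The upper bound on the count for `a` comes from the bound on `|R n|` and the lower bound for the
opposite bit. -/
theorem abs_ncard_sub_N_le {n L : ℕ} (hn : 0 < n) (hL : ∀ w ∈ R n, w.length ≤ L) (a : Bool) :
    |((REndingIn n a).ncard : ℝ) - (N n [a] : ℝ)| ≤ 3 * L + 3 := by
  have h1 := card_RFinset_lt hn
  have h2 := card_rightLeaves_le hL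
  have h3 := card_endingFinset_add hn
  have h4 := N_add_N n
  have h5 := N_le hL false
  have h6 := N_le hL true
  rw [ncard_REndingIn, abs_le]
  have h : N n [a] ≤ (endingFinset n a).card + (3 * L + 3) ∧
      (endingFinset n a).card ≤ N n [a] + (3 * L + 3) := by
    cases a <;> constructor <;> omega
  have h7 : (N n [a] : ℝ) ≤ (endingFinset n a).card + (3 * L + 3) := by exact_mod_cast h.1
  have h8 : ((endingFinset n a).card : ℝ) ≤ N n [a] + (3 * L + 3) := by exact_mod_cast h.2
  constructor <;> linarith

theorem ncard_sub_N_isLittleO (a : Bool) :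
    (fun n : ℕ => ((REndingIn n a).ncard : ℝ) - (N n [a] : ℝ)) =o[atTop]
      fun n : ℕ => (n : ℝ) := by
  rw [isLittleO_iff]
  intro c hc
  -- With `L = n / K ≥ 1` the error `3 * L + 3` is at most `6 * L`, hence at most `c * n`.
  obtain ⟨K, hK⟩ := exists_nat_gt (6 / c)
  have hK0 : 0 < K := by
    have : (0 : ℝ) < K := (div_pos (by norm_num) hc).trans hK
    exact_mod_cast this
  filter_upwards [eventually_ge_atTop (K * (40 * K + 40))] with n hn
  have hKn : K ≤ n := (Nat.le_mul_of_pos_right K (by omega)).trans hn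
  have hL : ∀ w ∈ R n, w.length ≤ n / K := fun w hw =>
    (Nat.le_div_iff_mul_le hK0).mpr (by rw [mul_comm]; exact mul_length_le hn hw)
  have h := abs_ncard_sub_N_le (by omega) hL a
  have h1 : 1 ≤ n / K := (Nat.one_le_div_iff hK0).mpr hKn
  have h2 : ((n / K : ℕ) : ℝ) ≤ n / K := Nat.cast_div_le
  have h3 : (1 : ℝ) ≤ ((n / K : ℕ) : ℝ) := by exact_mod_cast h1
  have hKr : (0 : ℝ) < K := by exact_mod_cast hK0
  have h4 : 6 * ((n : ℝ) / K) ≤ c * n := by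
    rw [div_lt_iff₀ hc] at hK
    rw [← mul_div_assoc, div_le_iff₀ hKr]
    nlinarith [(Nat.cast_nonneg n : (0 : ℝ) ≤ n)]
  rw [Real.norm_eq_abs, Real.norm_natCast]
  linarith

end EhrenfeuchtMycielski

theorem mainTheorem4 :
    ((fun n : ℕ => ((EhrenfeuchtMycielski.REndingIn n false).ncard : ℝ)
        - (EhrenfeuchtMycielski.N n [false] : ℝ)) =o[atTop] fun n : ℕ => (n : ℝ)) ∧
    ((fun n : ℕ => ((EhrenfeuchtMycielski.REndingIn n true).ncard : ℝ)
        - (EhrenfeuchtMycielski.N n [true] : ℝ)) =o[atTop] fun n : ℕ => (n : ℝ)) :=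
  ⟨EhrenfeuchtMycielski.ncard_sub_N_isLittleO false,
    EhrenfeuchtMycielski.ncard_sub_N_isLittleO true⟩
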